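/- Let $t\ge 1$ be an integer. Let $S_t$ be the set of all rational numbers $s=a/b$ in lowest terms with $0<b\le t$ (the slopes). For each $s=a/b\in S_t$ let $v_s=q\,(b,a)$ be the longest vector of the form $q\,(b,a)$, $q\in\mathbb Z$, whose first coordinate $x$ satisfies $0<x\le t$ (that is, $q=\lfloor t/b\rfloor$). The grid parabola $P_t$ is the bi-infinite polygonal chain in $\mathbb R^2$ formed by concatenating the vectors $v_s$, $s\in S_t$, in order of increasing slope, placed so that its horizontal edge goes from $(0,0)$ to $(t,0)$; its vertices lie in the grid $\mathbb Z^2$. Grid peeling of $P_t$ starts with the set $U_0$ of all points of $\mathbb Z^2$ on or above $P_t$. In each peeling step the vertices (extreme points) of the convex hull are removed: $U_{m+1}=U_m\setminus \operatorname{ext}(\operatorname{conv} U_m)$. The chain obtained after $m$ steps is the boundary of $\operatorname{conv} U_m$. **Theorem 2.** If $t$ is odd, then $P_t$ reappears one unit higher after exactly $t$ peeling steps: for every integer $m\ge 0$, the chain obtained after $m$ steps equals $P_t+(0,1)$ if and only if $m=t$. If $t$ is even, then $P_t$ reappears one unit higher after exactly $t+1$ peeling steps: for every integer $m\ge 0$,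 the chain obtained after $m$ steps equals $P_t+(0,1)$ if and only if $m=t+1$. -/

import Mathlib

/-- The slopes for the parameter `t`: the rational numbers `a / b` (in lowest terms, `b > 0`)
with `b ≤ t`. -/
def slopes (t : ℕ) : Set ℚ := {s | s.den ≤ t}

/-- The lattice vector `q • (b, a)` for the slope `s = a / b`, where `q = ⌊t / b⌋`. -/
def edgeVec (t : ℕ) (s : ℚ) : ℤ × ℤ := ((t / s.den : ℕ) : ℤ) • ((s.den : ℤ), s.num)

/-- For a slope `s = a / b`, the multiplier `⌊t / b⌋` is the largest integer `q` for which the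
first coordinate of `q • (b, a)` is in `(0, t]`; so `edgeVec t s` is the longest such vector. -/
theorem isGreatest_edgeVec_multiplier (t : ℕ) (s : ℚ) (hs : s ∈ slopes t) :
    IsGreatest {q : ℤ | 0 < (q • ((s.den : ℤ), s.num)).1 ∧ (q • ((s.den : ℤ), s.num)).1 ≤ t}
      ((t / s.den : ℕ) : ℤ) := by
  have hd : 0 < s.den := s.den_pos
  have hs' : s.den ≤ t := hs
  constructor
  · have h1 : 0 < t / s.den := Nat.div_pos hs' hd
    have h2 : t / s.den * s.den ≤ t := Nat.div_mul_le_self t s.den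
    simp only [Set.mem_ofPred_eq, Prod.smul_fst, smul_eq_mul]
    constructor
    · exact_mod_cast Nat.mul_pos h1 hd
    · exact_mod_cast h2
  · rintro q ⟨-, h⟩
    simp only [Prod.smul_fst, smul_eq_mul] at h
    push_cast
    exact (Int.le_ediv_iff_mul_le (by exact_mod_cast hd)).2 h

/-- There are only finitely many slopes in a bounded interval. -/
theorem finite_slopes_inter_Ico (t : ℕ) (u v : ℚ) : (slopes t ∩ Set.Ico u v).Finite := by
  obtain ⟨N, hN⟩ := exists_nat_ge (max |u| |v|)
  have hu : |u| ≤ N := le_trans (le_max_left _ _) hN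
  have hv : |v| ≤ N := le_trans (le_max_right _ _) hN
  refine Set.Finite.subset
    (((Set.finite_Icc (-(N * t : ℤ)) (N * t)).prod (Set.finite_Iic t)).image
      (fun p : ℤ × ℕ => (p.1 : ℚ) / (p.2 : ℚ))) ?_
  rintro s ⟨hs, h1, h2⟩
  have hs' : s.den ≤ t := hs
  have hsN : |s| ≤ N := abs_le.2 ⟨by linarith [(abs_le.1 hu).1], by linarith [(abs_le.1 hv).2]⟩
  have hd : (0 : ℚ) < s.den := by exact_mod_cast s.den_pos
  have hnum : |(s.num : ℚ)| ≤ N * t := by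
    have e : (s.num : ℚ) = s * s.den := (Rat.mul_den_eq_num s).symm
    rw [e, abs_mul, abs_of_pos hd]
    have : (s.den : ℚ) ≤ t := by exact_mod_cast hs'
    exact mul_le_mul hsN this hd.le (by positivity)
  have hnum' : |s.num| ≤ (N * t : ℤ) := by exact_mod_cast hnum
  exact ⟨(s.num, s.den), ⟨abs_le.1 hnum', hs'⟩, Rat.num_div_den s⟩

/-- The sum of the vectors `edgeVec t r` over all slopes `r` with `u ≤ r < v`. -/
noncomputable def edgeSum (t : ℕ) (u v : ℚ) : ℤ × ℤ :=
  ∑ r ∈ (finite_slopes_inter_Ico t u v).toFinset, edgeVec t r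

/-- The left endpoint of the edge of slope `s` when all vectors `edgeVec t r` are concatenated in
order of increasing slope `r`, with the left endpoint of the horizontal edge at the origin. -/
noncomputable def edgeStart (t : ℕ) (s : ℚ) : ℤ × ℤ :=
  if 0 ≤ s then edgeSum t 0 s else -edgeSum t s 0

/-- The inclusion of the integer grid into the plane. -/
def toPlane (p : ℤ × ℤ) : ℝ × ℝ := ((p.1 : ℝ), (p.2 : ℝ))

/-- The grid parabola: the infinite polygonal chain, as a subset of the plane, formed by
concatenating the vectors `edgeVec t s` in order of increasing slope `s`. -/
noncomputable def gridParabola (t : ℕ) : Set (ℝ × ℝ) :=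
  ⋃ s ∈ slopes t, segment ℝ (toPlane (edgeStart t s)) (toPlane (edgeStart t s + edgeVec t s))

/-- The points of the integer grid that lie on or above some point of the curve `C`. -/
def gridAbove (C : Set (ℝ × ℝ)) : Set (ℝ × ℝ) :=
  {p | p ∈ Set.range toPlane ∧ ∃ c ∈ C, c.1 = p.1 ∧ c.2 ≤ p.2}

/-- One peeling step: remove the vertices of the convex hull. -/
def peel (U : Set (ℝ × ℝ)) : Set (ℝ × ℝ) :=
  U \ (convexHull ℝ U).extremePoints ℝ

/-- The curve that results from `C` after `m` peeling steps: the boundary of the convex hull of the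
grid points that remain when `m` peeling steps are applied to the grid points on or above `C`. -/
def peeledCurve (C : Set (ℝ × ℝ)) (m : ℕ) : Set (ℝ × ℝ) :=
  frontier (convexHull ℝ (peel^[m] (gridAbove C)))

/-! If edges of length zero are allowed, peeling never changes the list of edge directions (b_i,
a_i). Neighbouring directions have determinant 1 and b_i + b_{i+1} > t, because the slopes are Farey
neighbours (`det_eq_one_of_covBy`). In one step, an edge of length at least 2 stays on its line and
loses one unit at each end; an edge of length 0 or 1 rises to the next grid line.

Which case occurs can be read off at either end. Let w = ⌊t/2⌋ and let d be the horizontal offset of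
vertex i from its start. Then line i - 1 is kept iff d - b_{i-1} ≥ -w, and line i is kept iff d +
b_i ≤ w. The invariant `exists_edge` shows that the two ends of every edge agree, so
`points_peelChain_succ` identifies these moves with peeling.

Hence the vertices evolve independently, each by a three-interval exchange of the window [-w, w].
The orbit of 0 is the whole window (`windowStep_orbit`), so the period is 2w + 1, which is t or t +
1 according to parity. In one period vertex i moves by b_{i-1}(b_i, a_i) - b_i(b_{i-1}, a_{i-1}) =
(0, 1). No other m works, because the remaining point sets strictly decrease. -/

theorem toPlane_injective : Function.Injective toPlane := by
  rintro ⟨a, b⟩ ⟨c, d⟩ h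
  simp only [toPlane, Prod.mk.injEq, Int.cast_inj] at h
  exact Prod.ext h.1 h.2

/-- A bi-infinite convex polygonal chain with vertices in the integer grid: the edge with index `i`
goes from `vert i` to `vert (i + 1)` and is `len i` times the vector `dir i`. Consecutive directions
form a positively oriented basis of the grid. Edges may have length zero. -/
structure LatticeChain where
  dir : ℤ → ℤ × ℤ
  vert : ℤ → ℤ × ℤ
  len : ℤ → ℤ
  dir_pos : ∀ i, 0 < (dir i).1
  det_eq_one : ∀ i, (dir i).1 * (dir (i + 1)).2 - (dir i).2 * (dir (i + 1)).1 = 1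
  len_nonneg : ∀ i, 0 ≤ len i
  vert_succ : ∀ i, vert (i + 1) = vert i + len i • dir i
  exists_le_vert : ∀ x : ℤ, ∃ i, x ≤ (vert i).1
  exists_vert_le : ∀ x : ℤ, ∃ i, (vert i).1 ≤ x

/-! ### Convex geometry of a lattice chain: hull, boundary, extreme points -/

namespace LatticeChain

variable (C : LatticeChain)

theorem vert_succ_fst (i : ℤ) :
    (C.vert (i + 1)).1 = (C.vert i).1 + C.len i * (C.dir i).1 := by
  simp [C.vert_succ i]

theorem vert_succ_snd (i : ℤ) :
    (C.vert (i + 1)).2 = (C.vert i).2 + C.len i * (C.dir i).2 := by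
  simp [C.vert_succ i]

/-- The signed height of a grid point above the line of the edge `i`, counted in grid lines. -/
def level (i : ℤ) (p : ℤ × ℤ) : ℤ :=
  (C.dir i).1 * (p.2 - (C.vert i).2) - (C.dir i).2 * (p.1 - (C.vert i).1)

/-- The extension of `level` to the plane. -/
def height (i : ℤ) (p : ℝ × ℝ) : ℝ :=
  (C.dir i).1 * (p.2 - (C.vert i).2) - (C.dir i).2 * (p.1 - (C.vert i).1)

theorem height_toPlane (i : ℤ) (p : ℤ × ℤ) : C.height i (toPlane p) = C.level i p := by
  simp [height, level, toPlane]

/-- The grid points on or above the chain. -/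
def points : Set (ℤ × ℤ) := {p | ∀ i, 0 ≤ C.level i p}

/-- The closed region above the chain. -/
def region : Set (ℝ × ℝ) := {p | ∀ i, 0 ≤ C.height i p}

/-- The chain as a subset of the plane. -/
def curve : Set (ℝ × ℝ) := ⋃ i, segment ℝ (toPlane (C.vert i)) (toPlane (C.vert (i + 1)))

theorem toPlane_mem_region {p : ℤ × ℤ} : toPlane p ∈ C.region ↔ p ∈ C.points := by
  simp [region, points, height_toPlane]

/-- The directions keep turning counterclockwise inside the right half-plane, so the sign passes
from neighbouring pairs to all pairs. -/
theorem cross_nonneg {i j : ℤ} (h : i ≤ j) :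
    0 ≤ (C.dir i).1 * (C.dir j).2 - (C.dir i).2 * (C.dir j).1 := by
  induction j, h using Int.leInduction with
  | base => exact (by ring : (0 : ℤ) = _).le
  | succ j _ ih =>
    have h1 := C.dir_pos j
    have h2 := C.dir_pos (j + 1)
    have h3 := C.dir_pos i
    have h4 := C.det_eq_one j
    refine nonneg_of_mul_nonneg_right ?_ h1
    have : (C.dir j).1 * ((C.dir i).1 * (C.dir (j + 1)).2 - (C.dir i).2 * (C.dir (j + 1)).1) =
        (C.dir (j + 1)).1 * ((C.dir i).1 * (C.dir j).2 - (C.dir i).2 * (C.dir j).1) +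
        (C.dir i).1 * ((C.dir j).1 * (C.dir (j + 1)).2 - (C.dir j).2 * (C.dir (j + 1)).1) := by
      ring
    rw [this, h4]
    positivity

theorem level_vert_succ (i j : ℤ) :
    C.level i (C.vert (j + 1)) = C.level i (C.vert j) +
      C.len j * ((C.dir i).1 * (C.dir j).2 - (C.dir i).2 * (C.dir j).1) := by
  simp only [level, C.vert_succ_fst, C.vert_succ_snd]
  ring

theorem level_self (i : ℤ) : C.level i (C.vert i) = 0 := by simp [level]

theorem level_self_succ (i : ℤ) : C.level i (C.vert (i + 1)) = 0 := by
  rw [level_vert_succ, level_self]; ring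

theorem vert_mem_points (j : ℤ) : C.vert j ∈ C.points := by
  intro i
  rcases le_total i j with h | h
  · induction j, h using Int.leInduction with
    | base => exact (C.level_self i).ge
    | succ j h ih =>
      rw [level_vert_succ]
      have := mul_nonneg (C.len_nonneg j) (C.cross_nonneg h)
      linarith
  · induction j, h using Int.leInductionDown with
    | base => exact (C.level_self i).ge
    | pred j h ih =>
      have h1 := C.level_vert_succ i (j - 1)
      rw [sub_add_cancel] at h1
      have h2 := mul_nonneg (C.len_nonneg (j - 1)) (C.cross_nonneg (by lia : j - 1 ≤ i))
      linarith

/-- A grid point in the region at which both lines through a vertex are active is the vertex. -/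
theorem eq_vert_of_level_eq_zero {i : ℤ} {p : ℤ × ℤ} (h : C.level i p = 0)
    (h' : C.level (i + 1) p = 0) : p = C.vert (i + 1) := by
  have h1 := C.level_self_succ i
  have h2 := C.det_eq_one i
  simp only [level] at h h' h1
  have hx : p.1 - (C.vert (i + 1)).1 = 0 := by
    linear_combination (-(p.1 - (C.vert (i + 1)).1)) * h2 - (C.dir i).1 * h' +
      (C.dir (i + 1)).1 * (h - h1)
  have hy : p.2 - (C.vert (i + 1)).2 = 0 := by
    linear_combination (-(p.2 - (C.vert (i + 1)).2)) * h2 - (C.dir i).2 * h' +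
      (C.dir (i + 1)).2 * (h - h1)
  exact Prod.ext (by linarith) (by linarith)

/-- The grid points of the region on the line of an edge of length at most one are its endpoints. -/
theorem eq_vert_or_eq_vert_succ {i : ℤ} (hlen : C.len i ≤ 1) {p : ℤ × ℤ} (hp : p ∈ C.points)
    (h : C.level i p = 0) : p = C.vert i ∨ p = C.vert (i + 1) := by
  have h1 := hp (i + 1)
  have h2 := hp (i - 1)
  have h3 := C.level_self_succ (i - 1)
  have h4 := C.det_eq_one (i - 1)
  rw [sub_add_cancel] at h3 h4
  -- On line i, the level over line i - 1 counts the grid steps from `vert i`, and the level over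
  -- line i + 1 counts those left to `vert (i + 1)`. If they sum to at most one, one of them
  -- vanishes.
  have key : C.level (i + 1) p + C.level (i - 1) p = C.len i := by
    refine mul_left_cancel₀ (C.dir_pos i).ne' ?_
    have h5 := C.det_eq_one i
    simp only [level, C.vert_succ_fst, C.vert_succ_snd] at h h3 ⊢
    linear_combination ((C.dir (i + 1)).1 + (C.dir (i - 1)).1) * h + (C.dir i).1 * h3 +
      (p.1 - (C.vert i).1) * (h4 - h5) + (C.dir i).1 * C.len i * h5
  rcases h1.eq_or_lt with h5 | h5
  · exact Or.inr (C.eq_vert_of_level_eq_zero h h5.symm)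
  · have h6 : C.level (i - 1) p = 0 := by lia
    have := C.eq_vert_of_level_eq_zero (i := i - 1) h6 (by rwa [sub_add_cancel])
    rw [sub_add_cancel] at this
    exact Or.inl this

theorem height_combo (i : ℤ) (p q : ℝ × ℝ) {α β : ℝ} (hαβ : α + β = 1) :
    C.height i (α • p + β • q) = α * C.height i p + β * C.height i q := by
  simp only [height, Prod.fst_add, Prod.snd_add, Prod.smul_fst, Prod.smul_snd, smul_eq_mul]
  linear_combination ((C.dir i).1 * (C.vert i).2 - (C.dir i).2 * (C.vert i).1 : ℝ) * hαβ

theorem convex_region : Convex ℝ C.region := by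
  intro p hp q hq α β hα hβ hαβ i
  have h1 := mul_nonneg hα (hp i)
  have h2 := mul_nonneg hβ (hq i)
  rw [C.height_combo i p q hαβ]; positivity

theorem continuous_height (i : ℤ) : Continuous (C.height i) := by
  unfold height; fun_prop

theorem isClosed_region : IsClosed C.region := by
  have : C.region = ⋂ i, {p | 0 ≤ C.height i p} := by
    ext p; simp [region]
  rw [this]
  exact isClosed_iInter fun i => isClosed_le continuous_const (C.continuous_height i)

theorem height_add_up (i : ℤ) (p : ℝ × ℝ) (c : ℝ) :
    C.height i (p + (0, c)) = C.height i p + (C.dir i).1 * c := by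
  simp only [height, Prod.fst_add, Prod.snd_add]; ring

theorem dir_pos_real (i : ℤ) : (0 : ℝ) < (C.dir i).1 := by exact_mod_cast C.dir_pos i

theorem region_add_up {p : ℝ × ℝ} (hp : p ∈ C.region) {c : ℝ} (hc : 0 ≤ c) :
    p + (0, c) ∈ C.region := by
  intro i
  rw [height_add_up]
  have := hp i
  have := C.dir_pos_real i
  positivity

theorem segment_subset_region (i : ℤ) :
    segment ℝ (toPlane (C.vert i)) (toPlane (C.vert (i + 1))) ⊆ C.region :=
  C.convex_region.segment_subset (C.toPlane_mem_region.2 (C.vert_mem_points i))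
    (C.toPlane_mem_region.2 (C.vert_mem_points (i + 1)))

theorem vert_fst_mono : Monotone fun i => (C.vert i).1 :=
  monotone_int_of_le_succ fun i => by
    have := mul_nonneg (C.len_nonneg i) (C.dir_pos i).le
    rw [vert_succ_fst]; linarith

theorem exists_fst_mem_Icc (x : ℝ) :
    ∃ i, ((C.vert i).1 : ℝ) ≤ x ∧ x ≤ (C.vert (i + 1)).1 := by
  obtain ⟨j, hj⟩ := C.exists_le_vert ⌈x⌉
  -- The -1 puts vertex k strictly to the left of x, so k bounds the candidate indices from below.
  obtain ⟨k, hk⟩ := C.exists_vert_le (⌈x⌉ - 1)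
  obtain ⟨i, hi, hmin⟩ := Int.exists_least_of_bdd (P := fun i => x ≤ (C.vert i).1)
    ⟨k, fun z hz => by
      by_contra! h
      have h1 := C.vert_fst_mono h.le
      have h2 : ⌈x⌉ ≤ (C.vert z).1 := Int.ceil_le.2 hz
      simp only at h1
      lia⟩ ⟨j, Int.ceil_le.1 hj⟩
  refine ⟨i - 1, ?_, by rwa [sub_add_cancel]⟩
  by_contra! h
  have := hmin (i - 1) h.le
  lia

/-- Points above the line of an edge are above the edge, within its horizontal range. -/
theorem exists_mem_segment_le {i : ℤ} {p : ℝ × ℝ} (h1 : ((C.vert i).1 : ℝ) ≤ p.1)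
    (h2 : p.1 ≤ (C.vert (i + 1)).1) (h : 0 ≤ C.height i p) :
    ∃ c ∈ segment ℝ (toPlane (C.vert i)) (toPlane (C.vert (i + 1))), c.1 = p.1 ∧ c.2 ≤ p.2 := by
  have hb := C.dir_pos_real i
  have hx : ((C.vert (i + 1)).1 : ℝ) = (C.vert i).1 + C.len i * (C.dir i).1 := by
    exact_mod_cast C.vert_succ_fst i
  have hy : ((C.vert (i + 1)).2 : ℝ) = (C.vert i).2 + C.len i * (C.dir i).2 := by
    exact_mod_cast C.vert_succ_snd i
  have hp : p.1 ∈ segment ℝ ((C.vert i).1 : ℝ) ((C.vert (i + 1)).1) := by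
    rw [segment_eq_Icc (h1.trans h2)]; exact ⟨h1, h2⟩
  obtain ⟨α, β, hα, hβ, hαβ, e⟩ := hp
  refine ⟨_, ⟨α, β, hα, hβ, hαβ, rfl⟩, ?_, ?_⟩
  · simpa [toPlane] using e
  · simp only [toPlane, Prod.snd_add, Prod.smul_snd, smul_eq_mul, hy]
    simp only [smul_eq_mul, hx] at e
    refine le_of_mul_le_mul_left ?_ hb
    simp only [height] at h
    obtain rfl : α = 1 - β := by linarith
    linear_combination h + ((C.dir i).2 : ℝ) * e

/-- The region consists of the points on or above the chain. -/
theorem mem_region_iff {p : ℝ × ℝ} : p ∈ C.region ↔ ∃ c ∈ C.curve, c.1 = p.1 ∧ c.2 ≤ p.2 := by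
  constructor
  · intro h
    obtain ⟨i, h1, h2⟩ := C.exists_fst_mem_Icc p.1
    obtain ⟨c, hc, h3⟩ := C.exists_mem_segment_le h1 h2 (h i)
    exact ⟨c, Set.mem_iUnion.2 ⟨i, hc⟩, h3⟩
  · rintro ⟨c, hc, h1, h2⟩
    obtain ⟨i, hi⟩ := Set.mem_iUnion.1 hc
    have := C.region_add_up (C.segment_subset_region i hi) (sub_nonneg.2 h2)
    convert this using 1
    ext <;> simp [h1]

theorem gridAbove_curve : gridAbove C.curve = toPlane '' C.points := by
  ext p
  simp only [gridAbove, ← mem_region_iff]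
  constructor
  · rintro ⟨⟨q, rfl⟩, h⟩
    exact ⟨q, C.toPlane_mem_region.1 h, rfl⟩
  · rintro ⟨q, hq, rfl⟩
    exact ⟨⟨q, rfl⟩, C.toPlane_mem_region.2 hq⟩

theorem vert_add_up_mem (i : ℤ) (n : ℕ) :
    toPlane (C.vert i) + (0, (n : ℝ)) ∈ toPlane '' C.points := by
  have h : toPlane (C.vert i) + (0, (n : ℝ)) = toPlane (C.vert i + (0, (n : ℤ))) := by
    simp [toPlane]
  rw [h]
  refine ⟨_, C.toPlane_mem_region.1 ?_, rfl⟩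
  rw [← h]
  exact C.region_add_up (C.toPlane_mem_region.2 (C.vert_mem_points i)) n.cast_nonneg

/-- Grid points lie at all natural heights above each vertex, so the hull contains all natural
vertical translates of each edge. Any point of the region lies vertically between an edge and such a
translate. -/
theorem convexHull_points : convexHull ℝ (toPlane '' C.points) = C.region := by
  refine subset_antisymm (convexHull_min ?_ C.convex_region) fun p hp => ?_
  · rintro _ ⟨q, hq, rfl⟩
    exact C.toPlane_mem_region.2 hq
  · obtain ⟨i, h1, h2⟩ := C.exists_fst_mem_Icc p.1
    obtain ⟨c, ⟨α, β, hα, hβ, hαβ, e⟩, h3, h4⟩ := C.exists_mem_segment_le h1 h2 (hp i)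
    obtain ⟨n, hn⟩ := exists_nat_gt (p.2 - c.2)
    have hn0 : (0 : ℝ) < n := by linarith
    have hconv := convex_convexHull ℝ (toPlane '' C.points)
    have mem (k : ℕ) : c + (0, (k : ℝ)) ∈ convexHull ℝ (toPlane '' C.points) := by
      have := hconv (subset_convexHull ℝ _ (C.vert_add_up_mem i k))
        (subset_convexHull ℝ _ (C.vert_add_up_mem (i + 1) k)) hα hβ hαβ
      convert this using 1
      rw [← e]
      ext
      · simp
      · simp only [Prod.snd_add, Prod.smul_snd, smul_eq_mul]
        linear_combination (-(k : ℝ)) * hαβ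
    have h0 := mem 0
    have h5 := hconv h0 (mem n) (a := 1 - (p.2 - c.2) / n) (b := (p.2 - c.2) / n)
      (by rw [sub_nonneg, div_le_one hn0]; exact hn.le) (div_nonneg (by linarith) hn0.le) (by ring)
    convert h5 using 1
    ext
    · simp only [Prod.fst_add, Prod.smul_fst, smul_eq_mul, h3]; ring
    · simp only [Prod.snd_add, Prod.smul_snd, smul_eq_mul, Nat.cast_zero]
      field_simp; ring

theorem exists_height_eq_zero {p : ℝ × ℝ} (hp : p ∈ C.curve) : ∃ i, C.height i p = 0 := by
  obtain ⟨i, α, β, hα, hβ, hαβ, rfl⟩ := Set.mem_iUnion.1 hp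
  refine ⟨i, ?_⟩
  rw [C.height_combo i _ _ hαβ, height_toPlane, height_toPlane, level_self, level_self_succ]
  simp

/-- For a point on line i, this turns nonnegative heights over the two neighbouring lines into the
horizontal bounds that put the point on edge i. -/
theorem height_succ (i : ℤ) (p : ℝ × ℝ) :
    (C.dir i).1 * C.height (i + 1) p =
      (C.dir (i + 1)).1 * C.height i p - (p.1 - (C.vert (i + 1)).1) := by
  have hx : ((C.vert (i + 1)).1 : ℝ) = (C.vert i).1 + C.len i * (C.dir i).1 := by
    exact_mod_cast C.vert_succ_fst i
  have hy : ((C.vert (i + 1)).2 : ℝ) = (C.vert i).2 + C.len i * (C.dir i).2 := by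
    exact_mod_cast C.vert_succ_snd i
  have hdet : ((C.dir i).1 * (C.dir (i + 1)).2 - (C.dir i).2 * (C.dir (i + 1)).1 : ℝ) = 1 := by
    exact_mod_cast C.det_eq_one i
  simp only [height, hx, hy]
  linear_combination (-(p.1 - (C.vert i).1 - C.len i * (C.dir i).1)) * hdet

theorem curve_subset_region : C.curve ⊆ C.region :=
  Set.iUnion_subset C.segment_subset_region

theorem mem_curve_of_height_eq_zero {i : ℤ} {p : ℝ × ℝ} (hp : p ∈ C.region)
    (h : C.height i p = 0) : p ∈ C.curve := by
  have h1 := C.height_succ i p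
  have h2 := C.height_succ (i - 1) p
  rw [sub_add_cancel] at h2
  have h3 := mul_nonneg (C.dir_pos_real i).le (hp (i + 1))
  have h4 := mul_nonneg (C.dir_pos_real i).le (hp (i - 1))
  rw [h] at h1 h2
  obtain ⟨c, hc, h5, h6⟩ := C.exists_mem_segment_le (i := i) (p := p) (by linarith) (by linarith)
    h.ge
  have h7 := C.segment_subset_region i hc i
  have h8 : p = c + (0, p.2 - c.2) := by ext <;> simp [h5]
  rw [h8, height_add_up] at h
  have h9 : p.2 - c.2 = 0 := by
    have := C.dir_pos_real i
    refine le_antisymm ?_ (sub_nonneg.2 h6)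
    by_contra! h10
    have := mul_pos this h10
    linarith
  rw [h9] at h8
  have : p = c := by rw [h8]; ext <;> simp
  exact this ▸ Set.mem_iUnion.2 ⟨i, hc⟩

theorem curve_subset_frontier : C.curve ⊆ frontier C.region := by
  intro p hp
  rw [C.isClosed_region.frontier_eq]
  refine ⟨C.curve_subset_region hp, fun hint => ?_⟩
  obtain ⟨i, hi⟩ := C.exists_height_eq_zero hp
  have hcont : Continuous fun c : ℝ => p + ((0 : ℝ), c) := by fun_prop
  have hnhds : ∀ᶠ c in nhds (0 : ℝ), p + ((0 : ℝ), c) ∈ C.region := by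
    refine hcont.continuousAt.eventually_mem ?_
    have : p + ((0 : ℝ), (0 : ℝ)) = p := by ext <;> simp
    rw [this]
    exact mem_interior_iff_mem_nhds.1 hint
  obtain ⟨ε, hε, hball⟩ := Metric.eventually_nhds_iff.1 hnhds
  have := hball (y := -(ε / 2)) (by simp [abs_of_pos hε, hε]) i
  rw [height_add_up, hi] at this
  nlinarith [C.dir_pos_real i]

/-- Infinitely many inequalities define the region, so positivity of all heights does not by itself
give an interior point. In a bounded vertical strip, however, finitely many edges suffice, since the
vertices are horizontally unbounded on both sides. -/
theorem frontier_region : frontier C.region = C.curve := by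
  refine subset_antisymm (fun p hp => ?_) C.curve_subset_frontier
  rw [C.isClosed_region.frontier_eq] at hp
  by_contra hpc
  refine hp.2 ?_
  obtain ⟨j, hj⟩ := C.exists_vert_le (⌈p.1⌉ - 1)
  obtain ⟨k, hk⟩ := C.exists_le_vert (⌊p.1⌋ + 1)
  have hj' : ((C.vert j).1 : ℝ) < p.1 := by
    have h1 : ((C.vert j).1 : ℝ) ≤ ⌈p.1⌉ - 1 := by exact_mod_cast hj
    have h2 := Int.ceil_lt_add_one p.1
    linarith
  have hk' : p.1 < (C.vert k).1 := by
    have h1 : (⌊p.1⌋ + 1 : ℝ) ≤ (C.vert k).1 := by exact_mod_cast hk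
    have h2 := Int.lt_floor_add_one p.1
    linarith
  have loc (x : ℝ) (h1 : ((C.vert j).1 : ℝ) < x) (h2 : x < (C.vert k).1) :
      ∃ i ∈ Finset.Ico j k, ((C.vert i).1 : ℝ) ≤ x ∧ x ≤ (C.vert (i + 1)).1 := by
    obtain ⟨i, h3, h4⟩ := C.exists_fst_mem_Icc x
    refine ⟨i, Finset.mem_Ico.2 ⟨?_, ?_⟩, h3, h4⟩
    · by_contra! h
      have : (C.vert (i + 1)).1 ≤ (C.vert j).1 := C.vert_fst_mono (by lia : i + 1 ≤ j)
      have : ((C.vert (i + 1)).1 : ℝ) ≤ (C.vert j).1 := by exact_mod_cast this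
      linarith
    · by_contra! h
      have : (C.vert k).1 ≤ (C.vert i).1 := C.vert_fst_mono h
      have : ((C.vert k).1 : ℝ) ≤ (C.vert i).1 := by exact_mod_cast this
      linarith
  have hU : IsOpen ({q : ℝ × ℝ | ((C.vert j).1 : ℝ) < q.1} ∩ {q : ℝ × ℝ | q.1 < (C.vert k).1} ∩
      ⋂ i ∈ Finset.Ico j k, {q | 0 < C.height i q}) := by
    refine ((isOpen_lt continuous_const continuous_fst).inter
      (isOpen_lt continuous_fst continuous_const)).inter ?_
    exact isOpen_biInter_finset fun i _ => isOpen_lt continuous_const (C.continuous_height i)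
  refine mem_interior.2 ⟨_, ?_, hU, ⟨⟨hj', hk'⟩, ?_⟩⟩
  · rintro q ⟨⟨h1, h2⟩, h3⟩
    obtain ⟨i, hi, h4, h5⟩ := loc q.1 h1 h2
    obtain ⟨c, hc, h6⟩ := C.exists_mem_segment_le h4 h5 (Set.mem_iInter₂.1 h3 i hi).le
    exact C.mem_region_iff.2 ⟨c, Set.mem_iUnion.2 ⟨i, hc⟩, h6⟩
  · exact Set.mem_iInter₂.2 fun i _ => (hp.1 i).lt_of_ne
      fun h => hpc (C.mem_curve_of_height_eq_zero hp.1 h.symm)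

theorem eq_toPlane_vert_of_height_eq_zero {i : ℤ} {p : ℝ × ℝ} (h : C.height i p = 0)
    (h' : C.height (i + 1) p = 0) : p = toPlane (C.vert (i + 1)) := by
  have h1 := C.height_succ i p
  rw [h, h'] at h1
  have h2 : p.1 = (C.vert (i + 1)).1 := by linarith
  simp only [height, h2, sub_self, mul_zero, sub_zero] at h'
  have h3 := (mul_eq_zero.1 h').resolve_left (C.dir_pos_real _).ne'
  exact Prod.ext h2 (sub_eq_zero.1 h3)

/-- An extreme point is a grid point; it lies on the chain, as otherwise it is inside a vertical
segment of the region; so it is an end of its edge. Conversely, a vertex is the only common point of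
its two lines, even if an adjacent edge has length zero. -/
theorem extremePoints_region : C.region.extremePoints ℝ = toPlane '' Set.range C.vert := by
  ext p
  constructor
  · intro hp
    obtain ⟨hpr, hext⟩ := mem_extremePoints_iff_left.1 hp
    obtain ⟨q, hq, rfl⟩ : p ∈ toPlane '' C.points :=
      extremePoints_convexHull_subset (C.convexHull_points ▸ hp)
    obtain ⟨i, h1, h2⟩ := C.exists_fst_mem_Icc (toPlane q).1
    obtain ⟨c, hc, h3, h4⟩ := C.exists_mem_segment_le h1 h2 (hpr i)
    have hcq : c = toPlane q := by
      by_contra hne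
      have hlt : c.2 < (toPlane q).2 := by
        refine h4.lt_of_ne fun h => hne (Prod.ext h3 h)
      refine hne (hext c (C.segment_subset_region i hc) (toPlane q + (0, 1))
        (C.region_add_up hpr zero_le_one) ?_)
      have hpos : 0 < (toPlane q).2 - c.2 := by linarith
      refine ⟨1 / (1 + ((toPlane q).2 - c.2)), ((toPlane q).2 - c.2) / (1 + ((toPlane q).2 - c.2)),
        by positivity, by positivity, by field_simp, ?_⟩
      ext
      · simp only [Prod.fst_add, Prod.smul_fst, smul_eq_mul, h3]; field_simp; ring
      · simp only [Prod.snd_add, Prod.smul_snd, smul_eq_mul]; field_simp; ring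
    rw [hcq] at hc
    have hv (j : ℤ) := C.toPlane_mem_region.2 (C.vert_mem_points j)
    obtain h | h := (mem_extremePoints_iff_forall_segment.1 hp).2 _ (hv i) _ (hv (i + 1)) hc
    · exact ⟨_, ⟨i, rfl⟩, h⟩
    · exact ⟨_, ⟨i + 1, rfl⟩, h⟩
  · rintro ⟨_, ⟨i, rfl⟩, rfl⟩
    refine mem_extremePoints_iff_left.2
      ⟨C.toPlane_mem_region.2 (C.vert_mem_points i), fun p hp q hq hpq => ?_⟩
    obtain ⟨α, β, hα, hβ, hαβ, e⟩ := hpq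
    have key (j : ℤ) (hj : C.level j (C.vert i) = 0) : C.height j p = 0 := by
      have h1 : C.height j (toPlane (C.vert i)) = 0 := by rw [height_toPlane, hj, Int.cast_zero]
      rw [← e, C.height_combo j p q hαβ] at h1
      have h3 := mul_nonneg hβ.le (hq j)
      have h4 := mul_nonneg hα.le (hp j)
      exact (mul_eq_zero.1 (by linarith : α * C.height j p = 0)).resolve_left hα.ne'
    have h1 := C.level_self_succ (i - 1)
    rw [sub_add_cancel] at h1
    have := C.eq_toPlane_vert_of_height_eq_zero (i := i - 1) (key _ h1)
      (by rw [sub_add_cancel]; exact key _ (C.level_self i))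
    rwa [sub_add_cancel] at this

theorem peel_points : peel (toPlane '' C.points) = toPlane '' (C.points \ Set.range C.vert) := by
  rw [peel, convexHull_points, extremePoints_region, Set.image_sdiff toPlane_injective]

end LatticeChain

/-! ### The orbit of 0 under the window map -/

/-- A three-interval exchange on the integers of the window `[-w, w]`, which subtracts `b`
if the result remains in the window, else adds `b'` if the result remains in the window, and
does both otherwise. -/
def windowStep (w b b' d : ℤ) : ℤ :=
  if b - w ≤ d then d - b else if d + b' ≤ w then d + b' else d + b' - b

section WindowStep

variable {w b b' : ℤ}

theorem windowStep_mem (hb0 : 0 < b) (hb0' : 0 < b') (hb : b ≤ 2 * w + 1) (hb' : b' ≤ 2 * w + 1)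
    {d : ℤ} (hd : d ∈ Finset.Icc (-w) w) : windowStep w b b' d ∈ Finset.Icc (-w) w := by
  rw [Finset.mem_Icc] at *
  unfold windowStep
  split_ifs <;> lia

theorem iterate_windowStep_mem (hb0 : 0 < b) (hb0' : 0 < b') (hb : b ≤ 2 * w + 1)
    (hb' : b' ≤ 2 * w + 1) (m : ℕ) : (windowStep w b b')^[m] 0 ∈ Finset.Icc (-w) w := by
  induction m with
  | zero => simp only [Function.iterate_zero, id, Finset.mem_Icc]; lia
  | succ m ih =>
    rw [Function.iterate_succ_apply']
    exact windowStep_mem hb0 hb0' hb hb' ih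

/-- The orbit of `0` in the window has full length `2 * w + 1`, and it uses the two kinds of
moves `b'` times and `b` times, respectively. -/
theorem windowStep_orbit (hb0 : 0 < b) (hb0' : 0 < b') (hb : b ≤ 2 * w + 1)
    (hb' : b' ≤ 2 * w + 1) (hsum : 2 * w + 1 ≤ b + b') (hcop : IsCoprime b b') (T : ℕ)
    (hT : (T : ℤ) = 2 * w + 1) :
    (((Finset.range T).filter fun j => ¬ (windowStep w b b')^[j] 0 + b' ≤ w).card : ℤ) = b' ∧
    (((Finset.range T).filter fun j => ¬ b - w ≤ (windowStep w b b')^[j] 0).card : ℤ) = b := by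
  set d : ℕ → ℤ := fun j => (windowStep w b b')^[j] 0 with hd
  have hmem (j : ℕ) : d j ∈ Finset.Icc (-w) w := iterate_windowStep_mem hb0 hb0' hb hb' j
  have hsucc (j : ℕ) : d (j + 1) = windowStep w b b' (d j) := Function.iterate_succ_apply' _ _ _
  let f : Finset.Icc (-w) w → Finset.Icc (-w) w :=
    fun x => ⟨windowStep w b b' x, windowStep_mem hb0 hb0' hb hb' x.2⟩
  -- The three branches are translations onto [-w, w - b], [b' - w, w] and the gap between them;
  -- these are disjoint because b + b' > 2w.
  have hf : Function.Injective f := by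
    rintro ⟨x, hx⟩ ⟨y, hy⟩ hxy
    have : windowStep w b b' x = windowStep w b b' y := congrArg Subtype.val hxy
    rw [Finset.mem_Icc] at hx hy
    rw [Subtype.mk.injEq]
    unfold windowStep at this
    split_ifs at this <;> lia
  let z : Finset.Icc (-w) w := ⟨0, hmem 0⟩
  have hz (j : ℕ) : (f^[j] z : ℤ) = d j := by
    induction j with
    | zero => rfl
    | succ j ih => rw [Function.iterate_succ_apply', hsucc, ← ih]
  obtain ⟨n, hn, hper, hinj⟩ : ∃ n, 0 < n ∧ d n = 0 ∧ Set.InjOn d (Set.Iio n) := by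
    refine ⟨Function.minimalPeriod f z,
      Function.minimalPeriod_pos_of_mem_periodicPts (hf.mem_periodicPts z), ?_, ?_⟩
    · rw [← hz, Function.iterate_minimalPeriod]
    · intro i hi j hj hij
      exact Function.iterate_injOn_Iio_minimalPeriod hi hj (Subtype.ext (by rw [hz, hz, hij]))
  have hcard (p : ℤ → Prop) [DecidablePred p] (s : Finset ℤ)
      (hs : ∀ x ∈ Finset.Icc (-w) w, p x → x ∈ s) :
      ((Finset.range n).filter fun j => p (d j)).card ≤ s.card := by
    refine Finset.card_le_card_of_injOn d (fun j hj => ?_) fun i hi j hj => ?_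
    · exact hs _ (hmem j) (Finset.mem_filter.1 hj).2
    · simp only [Finset.coe_filter, Finset.mem_range, Set.mem_ofPred_eq] at hi hj
      exact hinj hi.1 hj.1
  -- `A` counts the steps that subtract b and `B` those that add b'; a step doing both counts in
  -- each. Since the orbit points of one period are distinct, each count is bounded by the length of
  -- an interval.
  let A : ℕ → ℕ := fun m => ((Finset.range m).filter fun j => ¬ d j + b' ≤ w).card
  let B : ℕ → ℕ := fun m => ((Finset.range m).filter fun j => ¬ b - w ≤ d j).card
  have hAB (m : ℕ) : d m = B m * b' - A m * b := by
    induction m with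
    | zero => simp [A, B, d]
    | succ m ih =>
      have h := Finset.mem_Icc.1 (hmem m)
      simp only [A, B, Finset.range_add_one, Finset.filter_insert] at ih ⊢
      rw [hsucc, windowStep]
      split_ifs <;> (try rw [Finset.card_insert_of_notMem (by simp)]) <;>
        (try rw [Finset.card_insert_of_notMem (by simp)]) <;> push_cast <;> lia
  have hA : (A n : ℤ) ≤ b' := by
    have := hcard (fun x => ¬ x + b' ≤ w) (Finset.Ioc (w - b') w) fun x hx h => by
      rw [Finset.mem_Icc] at hx; rw [Finset.mem_Ioc]; lia
    rw [Int.card_Ioc] at this; lia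
  have hB : (B n : ℤ) ≤ b := by
    have := hcard (fun x => ¬ b - w ≤ x) (Finset.Ico (-w) (b - w)) fun x hx h => by
      rw [Finset.mem_Icc] at hx; rw [Finset.mem_Ico]; lia
    rw [Int.card_Ico] at this; lia
  have hboth : (((Finset.range n).filter fun j => ¬ d j + b' ≤ w ∧ ¬ b - w ≤ d j).card : ℤ) ≤
      b + b' - (2 * w + 1) := by
    have := hcard (fun x => ¬ x + b' ≤ w ∧ ¬ b - w ≤ x) (Finset.Ioo (w - b') (b - w))
      fun x hx h => by rw [Finset.mem_Icc] at hx; rw [Finset.mem_Ioo]; lia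
    rw [Int.card_Ioo] at this; lia
  have hone : ((Finset.range n).filter fun j => ¬ d j + b' ≤ w ∨ ¬ b - w ≤ d j).card = n := by
    rw [Finset.filter_true_of_mem, Finset.card_range]
    intro j _
    lia
  have hor := Finset.card_union_add_card_inter ((Finset.range n).filter fun j => ¬ d j + b' ≤ w)
    ((Finset.range n).filter fun j => ¬ b - w ≤ d j)
  rw [← Finset.filter_or, ← Finset.filter_and, hone] at hor
  change _ = A n + B n at hor
  have heq : (B n : ℤ) * b' = A n * b := by linarith [hAB n]
  -- Returning to 0 forces (A n, B n) = k(b', b), and the bounds leave k = 1. Subtracting the at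
  -- most b + b' - (2w + 1) double moves gives n ≥ 2w + 1, the size of the window.
  obtain ⟨k, hk⟩ : b ∣ (B n : ℤ) := hcop.dvd_of_dvd_mul_right ⟨A n, by linarith⟩
  have hAk : (A n : ℤ) = b' * k := by
    refine mul_right_cancel₀ hb0.ne' ?_
    rw [← heq, hk]; ring
  have hk1 : k = 1 := by
    have h1 : k ≤ 1 := by
      by_contra! h
      nlinarith
    have h2 : 0 < k := by
      by_contra! h
      have : b * k ≤ 0 := mul_nonpos_of_nonneg_of_nonpos hb0.le h
      have : b' * k ≤ 0 := mul_nonpos_of_nonneg_of_nonpos hb0'.le h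
      lia
    lia
  have hnT : n = T := by
    have h1 := hcard (fun _ => True) (Finset.Icc (-w) w) fun x hx _ => hx
    rw [Finset.filter_true_of_mem (by simp), Finset.card_range, Int.card_Icc] at h1
    subst hk1
    lia
  subst hnT hk1
  exact ⟨by linarith, by linarith⟩

end WindowStep

/-! ### Peeling dynamics of a full chain -/

namespace LatticeChain

/-- The edges of the chain are the longest multiples of the directions whose horizontal extent is
at most `t`, and no direction of horizontal extent at most `t` is missing. -/
structure IsFull (C : LatticeChain) (t : ℤ) : Prop where
  dir_le (i : ℤ) : (C.dir i).1 ≤ t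
  lt_add (i : ℤ) : t < (C.dir i).1 + (C.dir (i + 1)).1
  len_eq (i : ℤ) : C.len i = t / (C.dir i).1

variable (C : LatticeChain) (w : ℤ)

/-- The horizontal displacement of the vertex `i` after `m` peeling steps. -/
def offset (m : ℕ) (i : ℤ) : ℤ := (windowStep w (C.dir (i - 1)).1 (C.dir i).1)^[m] 0

/-- The vertex `i` after `m` peeling steps. -/
def peelVert : ℕ → ℤ → ℤ × ℤ
  | 0, i => C.vert i
  | m + 1, i => peelVert m i
      -- The two conditions mean that line i - 1, respectively line i, is kept. When one of the
      -- lines rises by a level, the vertex slides along the other by exactly one direction vector,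
      -- as the determinant is 1.
      + (if (C.dir (i - 1)).1 - w ≤ C.offset w m i then 0 else C.dir i)
      - (if C.offset w m i + (C.dir i).1 ≤ w then 0 else C.dir (i - 1))

theorem offset_succ (m : ℕ) (i : ℤ) :
    C.offset w (m + 1) i = windowStep w (C.dir (i - 1)).1 (C.dir i).1 (C.offset w m i) :=
  Function.iterate_succ_apply' _ _ _

theorem det_pred (i : ℤ) :
    (C.dir (i - 1)).1 * (C.dir i).2 - (C.dir (i - 1)).2 * (C.dir i).1 = 1 := by
  have := C.det_eq_one (i - 1)
  rwa [sub_add_cancel] at this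

/-- When line i rises, its ends slide along the two neighbouring directions; this relation makes the
new edge an integer multiple of `dir i` again. -/
theorem dir_add_dir (i : ℤ) : ∃ k : ℤ, C.dir (i + 1) + C.dir (i - 1) = k • C.dir i := by
  have h1 := C.det_eq_one i
  have h2 := C.det_pred i
  refine ⟨(C.dir (i - 1)).1 * (C.dir (i + 1)).2 - (C.dir (i - 1)).2 * (C.dir (i + 1)).1, ?_⟩
  ext
  · simp only [Prod.fst_add, Prod.smul_fst, smul_eq_mul]
    linear_combination (-(C.dir (i - 1)).1) * h1 - (C.dir (i + 1)).1 * h2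
  · simp only [Prod.snd_add, Prod.smul_snd, smul_eq_mul]
    linear_combination (-(C.dir (i - 1)).2) * h1 - (C.dir (i + 1)).2 * h2

theorem peelVert_eq_card (m : ℕ) (i : ℤ) : C.peelVert w m i = C.vert i +
    (((Finset.range m).filter fun j => ¬ (C.dir (i - 1)).1 - w ≤ C.offset w j i).card : ℤ) •
      C.dir i -
    (((Finset.range m).filter fun j => ¬ C.offset w j i + (C.dir i).1 ≤ w).card : ℤ) •
      C.dir (i - 1) := by
  induction m with
  | zero => simp [peelVert]
  | succ m ih =>
    rw [peelVert, ih]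
    simp only [Finset.range_add_one, Finset.filter_insert]
    split_ifs <;> (try rw [Finset.card_insert_of_notMem (by simp)]) <;>
      (try rw [Finset.card_insert_of_notMem (by simp)]) <;> push_cast <;> module

variable {C w} {t : ℤ} (hC : C.IsFull t) (ht : t = 2 * w ∨ t = 2 * w + 1)

include hC ht

theorem offset_mem (m : ℕ) (i : ℤ) : -w ≤ C.offset w m i ∧ C.offset w m i ≤ w := by
  have h1 := hC.dir_le (i - 1)
  have h2 := hC.dir_le i
  exact Finset.mem_Icc.1 (iterate_windowStep_mem (C.dir_pos _) (C.dir_pos _) (by lia) (by lia) m)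

/-- `peelVert` and `windowStep` would disagree only if both lines at a vertex were kept, which
b_{i-1} + b_i > t ≥ 2w excludes. -/
theorem peelVert_fst (m : ℕ) (i : ℤ) :
    (C.peelVert w m i).1 = (C.vert i).1 + C.offset w m i := by
  have h3 := hC.lt_add (i - 1)
  rw [sub_add_cancel] at h3
  induction m with
  | zero => simp [peelVert, offset]
  | succ m ih =>
    rw [offset_succ, windowStep, peelVert]
    simp only [Prod.fst_add, Prod.fst_sub, ih]
    split_ifs <;> (try simp only [Prod.fst_zero]) <;> lia

/-- The edge `i` after `m` peeling steps has a nonnegative integer length, and its endpoints agree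
about the number `j` of steps until its line is left. -/
theorem exists_edge (m : ℕ) (i : ℤ) : ∃ l j : ℤ, 0 ≤ j ∧ 0 ≤ l ∧ (j = 0 → l ≤ 1) ∧
    C.peelVert w m (i + 1) = C.peelVert w m i + l • C.dir i ∧
    -w ≤ C.offset w m (i + 1) - j * (C.dir i).1 ∧
    C.offset w m (i + 1) - j * (C.dir i).1 < (C.dir i).1 - w ∧
    w - (C.dir i).1 < C.offset w m i + j * (C.dir i).1 ∧
    C.offset w m i + j * (C.dir i).1 ≤ w := by
  have hb := C.dir_pos i
  have hbt := hC.dir_le i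
  have hq1 : C.len i * (C.dir i).1 ≤ t := by
    rw [hC.len_eq]; exact Int.ediv_mul_le _ hb.ne'
  have hq2 : t < (C.len i + 1) * (C.dir i).1 := by
    rw [hC.len_eq]; exact Int.lt_ediv_add_one_mul_self _ hb
  suffices h : ∃ l j : ℤ, 0 ≤ j ∧
      C.peelVert w m (i + 1) = C.peelVert w m i + l • C.dir i ∧
      -w ≤ C.offset w m (i + 1) - j * (C.dir i).1 ∧
      C.offset w m (i + 1) - j * (C.dir i).1 < (C.dir i).1 - w ∧
      w - (C.dir i).1 < C.offset w m i + j * (C.dir i).1 ∧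
      C.offset w m i + j * (C.dir i).1 ≤ w by
    -- Comparing first coordinates gives l·b = len·b + dR - dL, with dR, dL the offsets of the right
    -- and left end. The window bounds and t - b < len·b ≤ t then give l > -1, and l < 2 when j = 0.
    obtain ⟨l, j, hj, hl, h1, h2, h3, h4⟩ := h
    have h5 := congrArg Prod.fst hl
    simp only [Prod.fst_add, Prod.smul_fst, smul_eq_mul] at h5
    rw [peelVert_fst hC ht, peelVert_fst hC ht, C.vert_succ_fst] at h5
    have h6 := mul_nonneg hj hb.le
    refine ⟨l, j, hj, ?_, ?_, hl, h1, h2, h3, h4⟩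
    · by_contra! h
      have : (l + 1) * (C.dir i).1 ≤ 0 := mul_nonpos_of_nonpos_of_nonneg (by lia) hb.le
      lia
    · rintro rfl
      by_contra! h
      have : 0 ≤ (l - 2) * (C.dir i).1 := mul_nonneg (by lia) hb.le
      lia
  have ho1 (m : ℕ) := offset_mem hC ht m i
  have ho2 (m : ℕ) := offset_mem hC ht m (i + 1)
  have hs1 := hC.lt_add (i - 1)
  have hs2 := hC.lt_add i
  rw [sub_add_cancel] at hs1
  have hbt' := hC.dir_le (i + 1)
  have hbt'' := hC.dir_le (i - 1)
  induction m with
  | zero =>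
    refine ⟨C.len i, w / (C.dir i).1, Int.ediv_nonneg (by lia) hb.le, C.vert_succ i, ?_⟩
    have h1 := Int.ediv_mul_le w hb.ne'
    have h2 := Int.lt_ediv_add_one_mul_self w hb
    simp only [offset, Function.iterate_zero, id]
    lia
  | succ m ih =>
    obtain ⟨l, j, hj, hl, h1, h2, h3, h4⟩ := ih
    simp only [peelVert, offset_succ, add_sub_cancel_right]
    specialize ho1 m
    specialize ho2 m
    -- For j = 0 both ends leave the line. For j > 0 both move inwards by one direction vector, so l
    -- drops by 2 and j by 1.
    rcases hj.eq_or_lt with rfl | hj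
    · obtain ⟨k, hk⟩ := C.dir_add_dir i
      have hR1 : ¬ (C.dir i).1 - w ≤ C.offset w m (i + 1) := by lia
      have hL1 : ¬ C.offset w m i + (C.dir i).1 ≤ w := by lia
      rw [if_neg hR1, if_neg hL1]
      set dR := C.offset w m (i + 1)
      set dL := C.offset w m i
      set rR : ℤ := if dR + (C.dir (i + 1)).1 ≤ w then 0 else 1 with hrR
      set rL : ℤ := if (C.dir (i - 1)).1 - w ≤ dL then 0 else 1 with hrL
      have eR : (if dR + (C.dir (i + 1)).1 ≤ w then (0 : ℤ × ℤ) else C.dir i) = rR • C.dir i := by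
        rw [hrR]; split_ifs <;> simp
      have eL : (if (C.dir (i - 1)).1 - w ≤ dL then (0 : ℤ × ℤ) else C.dir i) = rL • C.dir i := by
        rw [hrL]; split_ifs <;> simp
      have wR : windowStep w (C.dir i).1 (C.dir (i + 1)).1 dR =
          dR + (C.dir (i + 1)).1 - rR * (C.dir i).1 := by
        rw [windowStep, if_neg hR1, hrR]; split_ifs <;> ring
      have wL : windowStep w (C.dir (i - 1)).1 (C.dir i).1 dL =
          dL - (C.dir (i - 1)).1 + rL * (C.dir i).1 := by
        rw [windowStep, if_neg hL1, hrL]; split_ifs <;> ring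
      have bR : w - (C.dir i).1 < dR + (C.dir (i + 1)).1 - rR * (C.dir i).1 ∧
          dR + (C.dir (i + 1)).1 - rR * (C.dir i).1 ≤ w := by
        rw [hrR]; split_ifs <;> lia
      have bL : -w ≤ dL - (C.dir (i - 1)).1 + rL * (C.dir i).1 ∧
          dL - (C.dir (i - 1)).1 + rL * (C.dir i).1 < (C.dir i).1 - w := by
        rw [hrL]; split_ifs <;> lia
      rw [eR, eL, wR, wL]
      have hl1 := congrArg Prod.fst hl
      simp only [Prod.fst_add, Prod.smul_fst, smul_eq_mul] at hl1
      rw [peelVert_fst hC ht, peelVert_fst hC ht, C.vert_succ_fst] at hl1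
      have hk1 := congrArg Prod.fst hk
      simp only [Prod.fst_add, Prod.smul_fst, smul_eq_mul] at hk1
      have e : dR + (C.dir (i + 1)).1 - rR * (C.dir i).1 -
          (dL - (C.dir (i - 1)).1 + rL * (C.dir i).1) =
          (l - C.len i + k - rR - rL) * (C.dir i).1 := by
        linear_combination hl1 + hk1
      refine ⟨l + k - rR - rL, l - C.len i + k - rR - rL, ?_, ?_, ?_⟩
      · by_contra! h
        have : (l - C.len i + k - rR - rL + 1) * (C.dir i).1 ≤ 0 :=
          mul_nonpos_of_nonpos_of_nonneg (by lia) hb.le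
        lia
      · rw [hl]
        have : C.dir (i + 1) = k • C.dir i - C.dir (i - 1) := eq_sub_of_add_eq hk
        rw [this]
        module
      · lia
    · have hjb : (C.dir i).1 ≤ j * (C.dir i).1 := le_mul_of_one_le_left hb.le (by lia)
      have hR1 : (C.dir i).1 - w ≤ C.offset w m (i + 1) := by lia
      have hL1 : C.offset w m i + (C.dir i).1 ≤ w := by lia
      have hR2 : ¬ C.offset w m (i + 1) + (C.dir (i + 1)).1 ≤ w := by lia
      have hL2 : ¬ (C.dir (i - 1)).1 - w ≤ C.offset w m i := by lia
      rw [windowStep, windowStep, if_pos hR1, if_pos hR1, if_neg hL2, if_neg hL2, if_pos hL1,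
        if_neg hR2, if_pos hL1, hl]
      refine ⟨l - 2, j - 1, by lia, by module, ?_⟩
      lia

/-- Each vertex follows its own rule, so the two ends of an edge must be shown to give the same
verdict on its line. They do, as both keep it exactly when the common j of `exists_edge` is
positive. -/
theorem stays_iff (m : ℕ) (i : ℤ) :
    (C.dir i).1 - w ≤ C.offset w m (i + 1) ↔ C.offset w m i + (C.dir i).1 ≤ w := by
  obtain ⟨l, j, hj, -, -, -, h1, h2, h3, h4⟩ := exists_edge hC ht m i
  have hb := C.dir_pos i
  rcases hj.eq_or_lt with rfl | hj
  · lia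
  · have hjb : (C.dir i).1 ≤ j * (C.dir i).1 := le_mul_of_one_le_left hb.le (by lia)
    constructor <;> intro <;> lia

/-- The chain after `m` peeling steps. -/
noncomputable def peelChain (m : ℕ) : LatticeChain where
  dir := C.dir
  vert := C.peelVert w m
  len i := (exists_edge hC ht m i).choose
  dir_pos := C.dir_pos
  det_eq_one := C.det_eq_one
  len_nonneg i := (exists_edge hC ht m i).choose_spec.choose_spec.2.1
  vert_succ i := (exists_edge hC ht m i).choose_spec.choose_spec.2.2.2.1
  exists_le_vert x := by
    obtain ⟨i, hi⟩ := C.exists_le_vert (x + w)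
    have := offset_mem hC ht m i
    exact ⟨i, by rw [peelVert_fst hC ht]; lia⟩
  exists_vert_le x := by
    obtain ⟨i, hi⟩ := C.exists_vert_le (x - w)
    have := offset_mem hC ht m i
    exact ⟨i, by rw [peelVert_fst hC ht]; lia⟩

theorem peelChain_len_le (m : ℕ) (i : ℤ) (h : ¬ C.offset w m i + (C.dir i).1 ≤ w) :
    (peelChain hC ht m).len i ≤ 1 := by
  obtain ⟨j, hj, -, h1, -, -, -, -, h2⟩ := (exists_edge hC ht m i).choose_spec
  refine h1 ?_
  by_contra hne
  have hjb : (C.dir i).1 ≤ j * (C.dir i).1 := le_mul_of_one_le_left (C.dir_pos i).le (by lia)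
  lia

theorem level_peelChain_succ (m : ℕ) (i : ℤ) (p : ℤ × ℤ) :
    (peelChain hC ht (m + 1)).level i p =
      (peelChain hC ht m).level i p - if C.offset w m i + (C.dir i).1 ≤ w then 0 else 1 := by
  have h := C.det_pred i
  simp only [level, peelChain, peelVert, Prod.fst_add, Prod.fst_sub, Prod.snd_add, Prod.snd_sub]
  split_ifs <;> (try simp only [Prod.fst_zero, Prod.snd_zero]) <;>
    first | linear_combination -h | ring

/-- A line rises only if its edge has length at most 1, so the grid points lost on it are vertices.
Conversely, every vertex is lost, since at least one of its two lines rises. -/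
theorem points_peelChain_succ (m : ℕ) : (peelChain hC ht (m + 1)).points =
    (peelChain hC ht m).points \ Set.range (peelChain hC ht m).vert := by
  ext p
  constructor
  · intro h
    refine ⟨fun i => ?_, ?_⟩
    · have := h i
      rw [level_peelChain_succ] at this
      split_ifs at this <;> lia
    · rintro ⟨i, rfl⟩
      have h1 := h i
      have h2 := h (i - 1)
      rw [level_peelChain_succ] at h1 h2
      have h3 := (peelChain hC ht m).level_self_succ (i - 1)
      have h4 := stays_iff hC ht m (i - 1)
      have h5 := hC.lt_add (i - 1)
      rw [sub_add_cancel] at h3 h4 h5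
      rw [level_self] at h1
      rw [h3] at h2
      split_ifs at h1 h2 <;> lia
  · rintro ⟨hp, hv⟩ i
    rw [level_peelChain_succ]
    split_ifs with h
    · simpa using hp i
    · by_contra! hlt
      have h0 : (peelChain hC ht m).level i p = 0 := le_antisymm (by lia) (hp i)
      obtain rfl | rfl := (peelChain hC ht m).eq_vert_or_eq_vert_succ
        (peelChain_len_le hC ht m i h) hp h0
      exacts [hv ⟨_, rfl⟩, hv ⟨_, rfl⟩]

theorem iterate_peel_points (m : ℕ) :
    peel^[m] (toPlane '' C.points) = toPlane '' (peelChain hC ht m).points := by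
  induction m with
  | zero => rfl
  | succ m ih => rw [Function.iterate_succ_apply', ih, peel_points, points_peelChain_succ]

theorem points_peelChain_antitone : Antitone fun m => (peelChain hC ht m).points :=
  antitone_nat_of_succ_le fun m => by
    rw [points_peelChain_succ]; exact Set.sdiff_subset

/-- The chain reappears one unit higher. -/
theorem peelVert_period (T : ℕ) (hT : (T : ℤ) = 2 * w + 1) (i : ℤ) :
    C.peelVert w T i = C.vert i + (0, 1) := by
  have h := C.det_pred i
  have h1 := hC.dir_le (i - 1)
  have h2 := hC.dir_le i
  have h3 := hC.lt_add (i - 1)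
  rw [sub_add_cancel] at h3
  obtain ⟨hA, hB⟩ := windowStep_orbit (w := w) (C.dir_pos (i - 1)) (C.dir_pos i) (by lia) (by lia)
    (by lia) ⟨(C.dir i).2, -(C.dir (i - 1)).2, by linear_combination h⟩ T hT
  rw [peelVert_eq_card]
  unfold offset
  rw [hA, hB]
  ext
  · simp only [Prod.fst_add, Prod.fst_sub, Prod.smul_fst, smul_eq_mul]; ring
  · simp only [Prod.snd_add, Prod.snd_sub, Prod.smul_snd, smul_eq_mul]; linear_combination h

theorem frontier_convexHull_iterate_peel (m : ℕ) :
    frontier (convexHull ℝ (peel^[m] (gridAbove C.curve))) = (peelChain hC ht m).curve := by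
  rw [gridAbove_curve, iterate_peel_points hC ht, convexHull_points, frontier_region]

/-- A vertex of the chain after m steps is removed in the next step and never comes back, so no
later chain can contain it. -/
theorem curve_peelChain_injective : Function.Injective fun m => (peelChain hC ht m).curve := by
  refine Function.Injective.of_lt_imp_ne fun m n hmn h => ?_
  have h1 : toPlane ((peelChain hC ht m).vert 0) ∈ (peelChain hC ht n).curve := by
    rw [← show (peelChain hC ht m).curve = (peelChain hC ht n).curve from h]
    exact Set.mem_iUnion.2 ⟨0, left_mem_segment ℝ _ _⟩
  have h2 := points_peelChain_antitone hC ht (Nat.succ_le_iff.2 hmn)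
    ((peelChain hC ht n).toPlane_mem_region.1 ((peelChain hC ht n).curve_subset_region h1))
  simp only at h2
  rw [points_peelChain_succ] at h2
  exact h2.2 ⟨0, rfl⟩

theorem curve_peelChain_period (T : ℕ) (hT : (T : ℤ) = 2 * w + 1) :
    (peelChain hC ht T).curve = (fun p : ℝ × ℝ => p + (0, 1)) '' C.curve := by
  have hv (i : ℤ) : toPlane ((peelChain hC ht T).vert i) = (0, 1) + toPlane (C.vert i) := by
    change toPlane (C.peelVert w T i) = _
    rw [peelVert_period hC ht T hT]
    ext <;> simp [toPlane, add_comm]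
  simp only [curve, Set.image_iUnion, hv, add_comm _ ((0 : ℝ), (1 : ℝ)),
    segment_translate_image]

theorem peeledCurve_eq_iff (T : ℕ) (hT : (T : ℤ) = 2 * w + 1) (m : ℕ) :
    peeledCurve C.curve m = (fun p : ℝ × ℝ => p + (0, 1)) '' C.curve ↔ m = T := by
  rw [peeledCurve, frontier_convexHull_iterate_peel hC ht, ← curve_peelChain_period hC ht T hT]
  exact (curve_peelChain_injective hC ht).eq_iff

end LatticeChain

/-! ### Farey neighbours, and the grid parabola as a full chain -/

/-- Consecutive fractions with denominators at most `t` have determinant one, and the sum of their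
denominators exceeds `t`. -/
theorem det_eq_one_of_covBy {t : ℕ} {s r : slopes t} (h : s ⋖ r) :
    ((s : ℚ).den : ℤ) * (r : ℚ).num - (s : ℚ).num * (r : ℚ).den = 1 ∧
      (t : ℤ) < (s : ℚ).den + (r : ℚ).den := by
  have hb : (0 : ℤ) < (s : ℚ).den := by exact_mod_cast (s : ℚ).den_pos
  have hd : (0 : ℤ) < (r : ℚ).den := by exact_mod_cast (r : ℚ).den_pos
  have hbt : ((s : ℚ).den : ℤ) ≤ t := by exact_mod_cast s.2
  have hdt : ((r : ℚ).den : ℤ) ≤ t := by exact_mod_cast r.2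
  have hlt : (s : ℚ) < r := h.lt
  have hcop (x : ℚ) : IsCoprime x.num (x.den : ℤ) := Int.isCoprime_iff_nat_coprime.2 x.reduced
  rw [Rat.lt_iff] at hlt
  obtain ⟨u, v, huv⟩ := hcop s
  obtain ⟨x, y, hxy, hx1, hx2⟩ : ∃ x y : ℤ, ((s : ℚ).den : ℤ) * y - (s : ℚ).num * x = 1 ∧
      (t : ℤ) - (s : ℚ).den < x ∧ x ≤ t := by
    have h1 := Int.emod_nonneg ((t : ℤ) + u) hb.ne'
    have h2 := Int.emod_lt_of_pos ((t : ℤ) + u) hb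
    have h3 := Int.emod_add_mul_ediv ((t : ℤ) + u) (s : ℚ).den
    -- The equation forces x ≡ -u modulo the denominator b of s; this is the representative in (t -
    -- b, t].
    refine ⟨t - ((t : ℤ) + u) % (s : ℚ).den,
      v + (s : ℚ).num * (((t : ℤ) + u) / (s : ℚ).den), ?_, by lia, by lia⟩
    linear_combination huv + (s : ℚ).num * h3
  have hx : 0 < x := by lia
  have hxq : (0 : ℚ) < x := by exact_mod_cast hx
  have hbq : (0 : ℚ) < (s : ℚ).den := by exact_mod_cast hb
  have hmem : (y : ℚ) / x ∈ slopes t := by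
    have h1 := Int.le_of_dvd hx (Rat.den_dvd y x)
    rw [Rat.divInt_eq_div] at h1
    have : (((y : ℚ) / x).den : ℤ) ≤ t := h1.trans hx2
    exact_mod_cast this
  have hle : (r : ℚ) ≤ (y : ℚ) / x := by
    let z : slopes t := ⟨(y : ℚ) / x, hmem⟩
    refine h.ge_of_gt (c := z) ?_
    change (s : ℚ) < (y : ℚ) / x
    rw [lt_div_iff₀ hxq, ← Rat.num_div_den (s : ℚ), div_mul_eq_mul_div, 
      div_lt_iff₀ (by simpa using hbq)]
    have : (s : ℚ).num * x < y * (s : ℚ).den := by linarith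
    exact_mod_cast this
  have hE : 0 ≤ y * (r : ℚ).den - x * (r : ℚ).num := by
    rw [le_div_iff₀ hxq, ← Rat.num_div_den (r : ℚ), div_mul_eq_mul_div,
      div_le_iff₀ (by exact_mod_cast hd)] at hle
    have : (r : ℚ).num * x ≤ y * (r : ℚ).den := by exact_mod_cast hle
    linarith
  set D : ℤ := (s : ℚ).den * (r : ℚ).num - (s : ℚ).num * (r : ℚ).den with hD
  set E : ℤ := y * (r : ℚ).den - x * (r : ℚ).num with hE'
  have hD0 : 0 < D := by linarith
  -- D and E are the determinants of s with r and of r with y/x. If E ≥ 1, the denominator of r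
  -- would be at least x + b > t; so E = 0 and r = y/x.
  have hsum : x * D + (s : ℚ).den * E = (r : ℚ).den := by
    linear_combination ((r : ℚ).den : ℤ) * hxy
  have hE0 : E = 0 := by
    by_contra hne
    have h1 : (s : ℚ).den ≤ (s : ℚ).den * E := le_mul_of_one_le_right hb.le (by lia)
    have h2 : x ≤ x * D := le_mul_of_one_le_right hx.le (by lia)
    lia
  rw [hE0] at hsum hE'
  have hDy : (r : ℚ).num = D * y := by
    refine mul_left_cancel₀ hx.ne' ?_
    linear_combination hE' - y * hsum
  have hD1 : D = 1 := by
    have := (hcop r).isUnit_of_dvd' ⟨y, hDy⟩ ⟨x, by linear_combination -hsum⟩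
    exact (Int.isUnit_iff.1 this).resolve_right (by lia)
  rw [hD1] at hsum
  exact ⟨hD1, by lia⟩

/-- The slopes, in increasing order, are indexed by the integers. -/
theorem nonempty_orderIso_slopes {t : ℕ} (ht : 0 < t) :
    Nonempty (ℤ ≃o slopes t) := by
  have hint (n : ℤ) {s : ℚ} (hs : s ∈ slopes t) : s + n ∈ slopes t := by
    have : (s + n).den = s.den := by simp
    exact this.le.trans hs
  let : LocallyFiniteOrder (slopes t) := LocallyFiniteOrder.ofFiniteIcc fun u v => by
    refine Set.Finite.of_finite_image (f := Subtype.val) ?_ Subtype.val_injective.injOn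
    refine (finite_slopes_inter_Ico t u (v + 1)).subset ?_
    rintro _ ⟨s, ⟨h1, h2⟩, rfl⟩
    exact ⟨s.2, h1, lt_of_le_of_lt (show (s : ℚ) ≤ v from h2) (lt_add_one _)⟩
  let : SuccOrder (slopes t) := LinearLocallyFiniteOrder.succOrder _
  let : PredOrder (slopes t) := LinearLocallyFiniteOrder.predOrder _
  have : NoMaxOrder (slopes t) := ⟨fun s => ⟨⟨_, hint 1 s.2⟩, by
    change (s : ℚ) < s + (1 : ℤ); push_cast; exact lt_add_one _⟩⟩
  have : NoMinOrder (slopes t) := ⟨fun s => ⟨⟨_, hint (-1) s.2⟩, by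
    change (s : ℚ) + (-1 : ℤ) < s; push_cast; linarith⟩⟩
  have : Nonempty (slopes t) := ⟨⟨0, show (0 : ℚ).den ≤ t from ht⟩⟩
  exact ⟨orderIsoIntOfLinearSuccPredArch.symm⟩

theorem edgeSum_add (t : ℕ) {u v x : ℚ} (h1 : u ≤ v) (h2 : v ≤ x) :
    edgeSum t u x = edgeSum t u v + edgeSum t v x := by
  rw [edgeSum, edgeSum, edgeSum, ← Finset.sum_union]
  · congr 1
    ext s
    simp only [Set.Finite.mem_toFinset, Finset.mem_union, ← Set.mem_union,
      ← Set.inter_union_distrib_left, Set.Ico_union_Ico_eq_Ico h1 h2]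
  · rw [Finset.disjoint_left]
    intro s hs hs'
    simp only [Set.Finite.mem_toFinset, Set.mem_inter_iff, Set.mem_Ico] at hs hs'
    exact absurd hs.2.2 (not_lt.2 hs'.2.1)

theorem edgeSum_of_covBy {t : ℕ} {s r : slopes t} (h : s ⋖ r) : edgeSum t s r = edgeVec t s := by
  have : (finite_slopes_inter_Ico t s r).toFinset = {(s : ℚ)} := by
    ext x
    simp only [Set.Finite.mem_toFinset, Set.mem_inter_iff, Set.mem_Ico, Finset.mem_singleton]
    constructor
    · rintro ⟨hx, h1, h2⟩
      by_contra hne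
      have h3 : (s : ℚ) < x := lt_of_le_of_ne h1 (Ne.symm hne)
      let z : slopes t := ⟨x, hx⟩
      exact h.2 (c := z) h3 h2
    · rintro rfl
      exact ⟨s.2, le_rfl, h.lt⟩
  rw [edgeSum, this, Finset.sum_singleton]

theorem edgeSum_self (t : ℕ) (u : ℚ) : edgeSum t u u = 0 := by
  simp [edgeSum]

theorem edgeStart_of_covBy {t : ℕ} (ht : 0 < t) {s r : slopes t} (h : s ⋖ r) :
    edgeStart t r = edgeStart t s + edgeVec t s := by
  rw [← edgeSum_of_covBy h]
  have hsr : (s : ℚ) < r := h.lt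
  unfold edgeStart
  rcases le_or_gt 0 (s : ℚ) with h1 | h1
  · rw [if_pos h1, if_pos (h1.trans hsr.le), edgeSum_add t h1 hsr.le]
  · let z : slopes t := ⟨0, show (0 : ℚ).den ≤ t from ht⟩
    have h2 : (r : ℚ) ≤ 0 := h.ge_of_gt (c := z) h1
    rw [if_neg h1.not_ge, edgeSum_add t hsr.le h2]
    split_ifs with h3
    · rw [le_antisymm h2 h3, edgeSum_self]; abel
    · abel

/-- The grid parabola as a full lattice chain. -/
theorem exists_latticeChain_eq_gridParabola {t : ℕ} (ht : 0 < t) :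
    ∃ C : LatticeChain, C.IsFull t ∧ C.curve = gridParabola t := by
  obtain ⟨σ⟩ := nonempty_orderIso_slopes ht
  have hcov (i : ℤ) : σ i ⋖ σ (i + 1) := by
    rw [apply_covBy_apply_iff]; exact Order.covBy_add_one i
  have hstart (i : ℤ) := edgeStart_of_covBy ht (hcov i)
  have hpos (i : ℤ) : (0 : ℤ) < ((σ i : ℚ)).den := by exact_mod_cast (σ i : ℚ).den_pos
  -- Every edge has horizontal extent at least 1, so the vertices are unbounded in both directions.
  have hmono : Monotone fun i : ℤ => (edgeStart t (σ i)).1 - i := by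
    refine monotone_int_of_le_succ fun i => ?_
    have h1 := (isGreatest_edgeVec_multiplier t (σ i) (σ i).2).1.1
    simp only [hstart i, edgeVec, Prod.fst_add]
    lia
  refine ⟨⟨fun i => ((σ i : ℚ).den, (σ i : ℚ).num), fun i => edgeStart t (σ i),
    fun i => ((t / (σ i : ℚ).den : ℕ) : ℤ), hpos, fun i => (det_eq_one_of_covBy (hcov i)).1,
    fun i => Int.natCast_nonneg _, hstart, fun x => ?_, fun x => ?_⟩,
    ⟨fun i => Int.ofNat_le.2 (σ i).2, fun i => (det_eq_one_of_covBy (hcov i)).2,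
      fun i => Int.natCast_div _ _⟩, ?_⟩
  · refine ⟨max 0 (x - (edgeStart t (σ 0)).1), ?_⟩
    have := hmono (le_max_left 0 (x - (edgeStart t (σ 0)).1))
    simp only at this
    lia
  · refine ⟨min 0 (x - (edgeStart t (σ 0)).1), ?_⟩
    have := hmono (min_le_left 0 (x - (edgeStart t (σ 0)).1))
    simp only at this
    lia
  · simp only [LatticeChain.curve, gridParabola, hstart]
    rw [← Set.iUnion_subtype (p := fun s => s ∈ slopes t) (s := fun s : slopes t =>
      segment ℝ (toPlane (edgeStart t s)) (toPlane (edgeStart t s + edgeVec t s)))]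
    exact σ.surjective.iUnion_comp fun s : slopes t =>
      segment ℝ (toPlane (edgeStart t s)) (toPlane (edgeStart t s + edgeVec t s))

theorem theorem2 (t : ℕ) (ht : 0 < t) :
    (Odd t → ∀ m : ℕ,
      peeledCurve (gridParabola t) m = (fun p : ℝ × ℝ => p + (0, 1)) '' gridParabola t ↔ m = t) ∧
    (Even t → ∀ m : ℕ,
      peeledCurve (gridParabola t) m = (fun p : ℝ × ℝ => p + (0, 1)) '' gridParabola t ↔
        m = t + 1) := by
  obtain ⟨C, hC, hcurve⟩ := exists_latticeChain_eq_gridParabola ht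
  rw [← hcurve]
  constructor
  · rintro ⟨k, rfl⟩ m
    exact LatticeChain.peeledCurve_eq_iff (w := k) hC
      (Or.inr (by push_cast; ring)) _ (by push_cast; ring) m
  · rintro ⟨k, rfl⟩ m
    exact LatticeChain.peeledCurve_eq_iff (w := k) hC
      (Or.inl (by push_cast; ring)) _ (by push_cast; ring) m
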